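/- Let $(X,d)$ be a compact metric space and $f:X\to X$ a continuous map for which the metric is adapted, i.e. there are $\lambda>1$ and $\varepsilon>0$ such that $d(x,y)<\varepsilon$ implies $d(f(x),f(y))\ge\lambda\, d(x,y)$ for all $x,y\in X$. Let $\mathcal M=\{R_1,\dots,R_n\}$ be a Markov partition for $f$, that is, a finite cover of $X$ by nonempty sets $R_i$ with $R_i=\overline{\operatorname{int}(R_i)}$ and with pairwise disjoint interiors, such that (1) for every sequence $(x_k)_{k\ge 0}$ in $\{1,\dots,n\}$ the set $\bigcap_{k=0}^\infty f^{-k}(\operatorname{int}(R_{x_k}))$ contains at most one point; (2) for all $i,j$ (possibly equal), if $f(\operatorname{int}(R_i))\cap\operatorname{int}(R_j)\ne\emptyset$, then every $y\in\operatorname{int}(R_j)$ has exactly one preimage under $f$ in $R_i$. Put $\partial\mathcal M:=\bigcup_{i=1}^n\partial R_i$, where $\partial R_i$ is the topological boundary of $R_i$. Then $f(\partial\mathcal M)\subset\partial\mathcal M$ and $$\dim_H(\partial\mathcal M)\le\frac{h(f|_{\partial\mathcal M})}{\log\lambda},$$ where $\dim_H$ is the Hausdorff dimension with respect to $d$ and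 $h$ is topological entropy (the map of the empty space has entropy $0$ by convention). -/

import Mathlib

open Set
open scoped ENNReal

/-- The metric of `X` is adapted to `f` with expansion factor `lam`: `1 < lam` and, for some
`ε > 0`, all points at distance less than `ε` satisfy `d (f x) (f y) ≥ lam * d x y`. -/
def IsAdapted {X : Type*} [MetricSpace X] (f : X → X) (lam : ℝ) : Prop :=
  1 < lam ∧ ∃ ε : ℝ, 0 < ε ∧ ∀ x y : X, dist x y < ε → lam * dist x y ≤ dist (f x) (f y)

/-- A set is proper if it is nonempty and equal to the closure of its interior. -/
def IsProperSet {X : Type*} [TopologicalSpace X] (R : Set X) : Prop :=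
  R = closure (interior R) ∧ R.Nonempty

/-- A Markov partition for `f`: a finite cover `R 0, …, R (n - 1)` of the space by proper sets
with pairwise disjoint interiors, metrically generating and with the Markov property. -/
structure IsMarkovPartition {X : Type*} [TopologicalSpace X] (f : X → X) {n : ℕ}
    (R : Fin n → Set X) : Prop where
  proper : ∀ i, IsProperSet (R i)
  cover : ⋃ i, R i = univ
  disjoint_interior : ∀ i j, i ≠ j → Disjoint (interior (R i)) (interior (R j))
  generating : ∀ a : ℕ → Fin n, (⋂ k : ℕ, f^[k] ⁻¹' interior (R (a k))).Subsingleton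
  markov : ∀ i j, (f '' interior (R i) ∩ interior (R j)).Nonempty →
    ∀ y ∈ interior (R j), ∃! x, x ∈ R i ∧ f x = y

/-- The boundary of a partition: the union of the topological boundaries of its members. -/
def partitionBoundary {X : Type*} [TopologicalSpace X] {n : ℕ} (R : Fin n → Set X) : Set X :=
  ⋃ i, frontier (R i)

/-- The Bowen–Dinaburg topological entropy of a self-map of a whole space, as an element of
`[0, ∞]`. On a nonempty space Mathlib's `coverEntropy` is nonnegative and `toENNReal` changes
nothing; on the empty space (where Mathlib gives `-∞`) the entropy is `0` by convention. -/
noncomputable def topEntropy {Y : Type*} [UniformSpace Y] (g : Y → Y) : ℝ≥0∞ :=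
  (Dynamics.coverEntropy g univ).toENNReal

open Filter Topology MeasureTheory

/-! Invariance: a boundary point `x` of `R i` also lies in some other `R k`. If `f x` were interior
to `R j`, points `w` of `interior (R i)` near `x` would have images with preimages `z ∈ R k`, close
to `x` by compactness. Local expansion makes `f` injective at that scale, so `z = w`, although
`interior (R i)` misses `R k`. Dimension: orbits that stay `ε`-close for `n` steps start within `ε /
lam ^ n`, so efficient covers by dynamical balls, counted by entropy, are covers by small sets and
bound Hausdorff measure (`IsAdapted.hausdorffMeasure_ne_top`). This part holds for any set. -/

/-- Near a point `x` which is the only preimage of `f x` in a compact set `K`, the preimages in `K`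
of points close to `f x` are close to `x`. -/
lemma eventually_dist_lt_of_unique_preimage {X : Type*} [MetricSpace X] {f : X → X}
    (hf : Continuous f) {K : Set X} (hK : IsCompact K) {x : X}
    (hx : ∀ z ∈ K, f z = f x → z = x) {δ : ℝ} (hδ : 0 < δ) :
    ∀ᶠ y in 𝓝 (f x), ∀ z ∈ K, f z = y → dist z x < δ := by
  have hc : IsClosed (f '' (K \ Metric.ball x δ)) :=
    ((hK.diff Metric.isOpen_ball).image hf).isClosed
  have hmem : (f '' (K \ Metric.ball x δ))ᶜ ∈ 𝓝 (f x) := by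
    refine hc.isOpen_compl.mem_nhds ?_
    rintro ⟨z, ⟨hzK, hz⟩, hzx⟩
    rw [hx z hzK hzx] at hz
    exact hz (Metric.mem_ball_self hδ)
  filter_upwards [hmem] with y hy z hz hzy
  by_contra hd
  exact hy ⟨z, ⟨hz, hd⟩, hzy⟩

namespace IsMarkovPartition

variable {X : Type*} {n : ℕ} {f : X → X} {R : Fin n → Set X}

lemma isClosed [TopologicalSpace X] (hR : IsMarkovPartition f R) (i : Fin n) :
    IsClosed (R i) := by
  rw [(hR.proper i).1]
  exact isClosed_closure

/-- A boundary point of one member of a Markov partition belongs to another member. -/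
lemma exists_ne_mem_of_mem_frontier [TopologicalSpace X] (hR : IsMarkovPartition f R) {i : Fin n}
    {x : X} (hx : x ∈ frontier (R i)) : ∃ k, k ≠ i ∧ x ∈ R k := by
  have hcl : IsClosed (⋃ k ∈ {k | k ≠ i}, R k) :=
    (toFinite _).isClosed_biUnion fun k _ => hR.isClosed k
  have hsub : (R i)ᶜ ⊆ ⋃ k ∈ {k | k ≠ i}, R k := by
    intro y hy
    obtain ⟨k, hk⟩ := mem_iUnion.1 (hR.cover.symm ▸ mem_univ y : y ∈ ⋃ i, R i)
    exact mem_biUnion (show k ≠ i from fun h => hy (h ▸ hk)) hk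
  have hx' : x ∈ closure (R i)ᶜ := (frontier_eq_closure_inter_closure (s := R i) ▸ hx).2
  simpa using closure_minimal hsub hcl hx'

/-- If the image of a point of `R i` lies in the interior of `R j`, then every point of the
interior of `R j` has exactly one preimage in `R i`. -/
lemma existsUnique_preimage [TopologicalSpace X] (hR : IsMarkovPartition f R) (hf : Continuous f)
    {i j : Fin n} {x : X} (hx : x ∈ R i) (hfx : f x ∈ interior (R j)) :
    ∀ y ∈ interior (R j), ∃! z, z ∈ R i ∧ f z = y := by
  apply hR.markov i j
  rw [(hR.proper i).1] at hx
  -- Density of `interior (R i)` in `R i` moves `x` to an interior point, as the Markov property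
  -- demands.
  obtain ⟨z, hz, hzi⟩ := mem_closure_iff.1 hx _ (isOpen_interior.preimage hf) hfx
  exact ⟨f z, mem_image_of_mem f hzi, hz⟩

lemma disjoint_interior_left [TopologicalSpace X] (hR : IsMarkovPartition f R) {i k : Fin n}
    (hik : i ≠ k) : Disjoint (interior (R i)) (R k) := by
  rw [(hR.proper k).1]
  exact (hR.disjoint_interior i k hik).closure_right isOpen_interior

/-- The boundary of a Markov partition is forward invariant. -/
lemma mapsTo_partitionBoundary [MetricSpace X] [CompactSpace X] (hR : IsMarkovPartition f R)
    (hf : Continuous f) {lam : ℝ} (hlam : IsAdapted f lam) :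
    MapsTo f (partitionBoundary R) (partitionBoundary R) := by
  obtain ⟨hl, ε, hε, hexp⟩ := hlam
  intro x hx
  obtain ⟨i, hi⟩ := mem_iUnion.1 hx
  obtain ⟨k, hki, hk⟩ := hR.exists_ne_mem_of_mem_frontier hi
  obtain ⟨j, hj⟩ := mem_iUnion.1 (hR.cover.symm ▸ mem_univ (f x) : f x ∈ ⋃ i, R i)
  by_contra hfx
  have hfj : f x ∈ interior (R j) := by
    by_contra hnot
    exact hfx (mem_iUnion.2 ⟨j, subset_closure hj, hnot⟩)
  have hiR : x ∈ R i := (hR.isClosed i).frontier_subset hi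
  have huk := hR.existsUnique_preimage hf hk hfj
  have hev := eventually_dist_lt_of_unique_preimage hf (hR.isClosed k).isCompact
    (fun z hz hzx => (huk _ hfj).unique ⟨hz, hzx⟩ ⟨hk, rfl⟩) (half_pos hε)
  have hev' := (hf.tendsto x).eventually (hev.and (isOpen_interior.mem_nhds hfj))
  have hxi : x ∈ closure (interior (R i)) := (hR.proper i).1 ▸ hiR
  obtain ⟨w, ⟨⟨hw, hwj⟩, hwx⟩, hwi⟩ := ((mem_closure_iff_frequently.1 hxi).and_eventually
    (hev'.and (Metric.ball_mem_nhds x (half_pos hε)))).exists.imp fun w h => h.symm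
  obtain ⟨z, hzk, hzw⟩ := (huk _ hwj).exists
  have hd : dist z w < ε := by
    have h1 := hw z hzk hzw
    have h2 : dist w x < ε / 2 := hwx
    linarith [dist_triangle_right z w x]
  -- Since `f z = f w`, expansion leaves `lam * dist z w ≤ 0`.
  have h0 := hexp z w hd
  rw [hzw, dist_self] at h0
  have hzw' : z = w := by
    by_contra hne
    linarith [mul_pos (zero_lt_one.trans hl) (dist_pos.2 hne)]
  exact disjoint_left.1 (hR.disjoint_interior_left hki.symm) hwi (hzw' ▸ hzk)

end IsMarkovPartition

/-- Points whose orbits stay `ε`-close up to time `n` are exponentially close, if `f` expands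
distances smaller than `ε` by the factor `lam`. -/
lemma pow_mul_dist_le_of_forall_dist_iterate_lt {X : Type*} [MetricSpace X] {f : X → X}
    {lam ε : ℝ} (hl : 0 ≤ lam) (hexp : ∀ x y, dist x y < ε → lam * dist x y ≤ dist (f x) (f y))
    {x y : X} {n : ℕ} (h : ∀ k < n, dist (f^[k] x) (f^[k] y) < ε) :
    lam ^ n * dist x y ≤ dist (f^[n] x) (f^[n] y) := by
  induction n with
  | zero => simp
  | succ n ih =>
    rw [Function.iterate_succ_apply', Function.iterate_succ_apply', pow_succ', mul_assoc]
    exact (mul_le_mul_of_nonneg_left (ih fun k hk => h k (hk.trans n.lt_succ_self)) hl).trans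
      (hexp _ _ (h n n.lt_succ_self))

/-- A dynamical ball of radius `ε / 2` and length `n + 1` has diameter at most `ε / lam ^ n`. -/
lemma ediam_ball_dynEntourage_le {X : Type*} [MetricSpace X] {f : X → X} {lam ε : ℝ}
    (hl : 0 < lam) (hexp : ∀ x y, dist x y < ε → lam * dist x y ≤ dist (f x) (f y))
    (x : X) (n : ℕ) :
    Metric.ediam {y | (y, x) ∈ Dynamics.dynEntourage f {p | dist p.1 p.2 < ε / 2} (n + 1)} ≤
      ENNReal.ofReal (ε / lam ^ n) := by
  refine Metric.ediam_le fun y hy z hz => ?_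
  rw [mem_ofPred_eq, Dynamics.mem_dynEntourage] at hy hz
  have hyz : ∀ k < n + 1, dist (f^[k] y) (f^[k] z) < ε := fun k hk => by
    have h1 : dist (f^[k] y) (f^[k] x) < ε / 2 := hy k hk
    have h2 : dist (f^[k] z) (f^[k] x) < ε / 2 := hz k hk
    linarith [dist_triangle_right (f^[k] y) (f^[k] z) (f^[k] x)]
  rw [edist_dist]
  apply ENNReal.ofReal_le_ofReal
  rw [le_div_iff₀' (pow_pos hl n)]
  exact (pow_mul_dist_le_of_forall_dist_iterate_lt hl.le hexp
    fun k hk => hyz k (hk.trans n.lt_succ_self)).trans (hyz n n.lt_succ_self).le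

/-- If the entropy of `f` on `F` is less than `d * log lam`, then the `d`-dimensional Hausdorff
measure of `F` is finite. -/
lemma IsAdapted.hausdorffMeasure_ne_top {X : Type*} [MetricSpace X] [MeasurableSpace X]
    [BorelSpace X] {f : X → X} {lam : ℝ} (hlam : IsAdapted f lam) {F : Set X} {d : NNReal}
    (h : Dynamics.coverEntropy f F < ((d * Real.log lam : ℝ) : EReal)) :
    Measure.hausdorffMeasure (d : ℝ) F ≠ ⊤ := by
  obtain ⟨hl, ε, hε, hexp⟩ := hlam
  have hl0 : 0 < lam := zero_lt_one.trans hl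
  set U : SetRel X X := {p | dist p.1 p.2 < ε / 2}
  have hent : Dynamics.coverEntropyEntourage f F U < ((d * Real.log lam : ℝ) : EReal) :=
    (Dynamics.coverEntropyEntourage_le_coverEntropy f F
      (Metric.dist_mem_uniformity (half_pos hε))).trans_lt h
  have hev := (tendsto_add_atTop_nat 1).eventually (ExpGrowth.eventually_le_exp hent)
  -- The entropy bound holds only for large `n`; the implication lets `s n` be chosen for every `n`,
  -- with `∅` as a dummy value.
  have hcov : ∀ n : ℕ, ∃ s : Finset X,
      ((Dynamics.coverMincard f F U (n + 1) : ENNReal) ≤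
          EReal.exp (((d * Real.log lam : ℝ) : EReal) * ((n + 1 : ℕ) : EReal)) →
        Dynamics.IsDynCoverOf f F U (n + 1) s ∧
        (s.card : ENNReal) ≤ ENNReal.ofReal (lam ^ (n + 1)) ^ (d : ℝ)) := by
    intro n
    by_cases hn : (Dynamics.coverMincard f F U (n + 1) : ENNReal) ≤
          EReal.exp (((d * Real.log lam : ℝ) : EReal) * ((n + 1 : ℕ) : EReal))
    · have hexp' : EReal.exp (((d * Real.log lam : ℝ) : EReal) * ((n + 1 : ℕ) : EReal)) =
          ENNReal.ofReal (lam ^ (n + 1)) ^ (d : ℝ) := by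
        rw [ENNReal.ofReal_rpow_of_pos (pow_pos hl0 _), ← EReal.coe_natCast, ← EReal.coe_mul,
          EReal.exp_coe, Real.rpow_def_of_pos (pow_pos hl0 _), Real.log_pow]
        congr 2
        ring
      rw [hexp'] at hn
      have hfin : Dynamics.coverMincard f F U (n + 1) < ⊤ := by
        rw [lt_top_iff_ne_top]
        intro htop
        rw [htop] at hn
        exact (ENNReal.rpow_lt_top_of_nonneg d.coe_nonneg ENNReal.ofReal_ne_top).not_ge hn
      obtain ⟨s, hs, hcard⟩ := (Dynamics.coverMincard_finite_iff f F U (n + 1)).1 hfin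
      refine ⟨s, fun _ => ⟨hs, ?_⟩⟩
      rw [← hcard] at hn
      simpa using hn
    · exact ⟨∅, fun h' => absurd h' hn⟩
  choose s hs using hcov
  have hcover : ∀ᶠ n in atTop, Dynamics.IsDynCoverOf f F U (n + 1) (s n) ∧
      ((s n).card : ENNReal) ≤ ENNReal.ofReal (lam ^ (n + 1)) ^ (d : ℝ) :=
    hev.mono fun n hn => hs n hn
  have hdiam : ∀ (n : ℕ) (x : X),
      Metric.ediam {y | (y, x) ∈ Dynamics.dynEntourage f U (n + 1)} ≤
        ENNReal.ofReal (ε / lam ^ n) := fun n x => ediam_ball_dynEntourage_le hl0 hexp x n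
  have hr : Tendsto (fun n : ℕ => ENNReal.ofReal (ε / lam ^ n)) atTop (𝓝 0) := by
    rw [← ENNReal.ofReal_zero]
    exact ENNReal.tendsto_ofReal
      (tendsto_const_nhds.div_atTop (tendsto_pow_atTop_atTop_of_one_lt hl))
  have hle := Measure.hausdorffMeasure_le_liminf_sum (ι := fun n => s n) (d : ℝ) F _ hr
    (fun n x => {y | (y, (x : X)) ∈ Dynamics.dynEntourage f U (n + 1)})
    (Eventually.of_forall fun n x => hdiam n x)
    (hcover.mono fun n hn y hy => by
      obtain ⟨x, hx, hyx⟩ := hn.1 hy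
      exact mem_iUnion.2 ⟨⟨x, hx⟩, hyx⟩)
  -- At most `lam ^ ((n + 1) * d)` balls of diameter at most `ε / lam ^ n`: the powers cancel up to
  -- one factor `lam`.
  have hbound : ∀ᶠ n in atTop,
      ∑ x : s n, Metric.ediam {y | (y, (x : X)) ∈ Dynamics.dynEntourage f U (n + 1)} ^ (d : ℝ) ≤
        ENNReal.ofReal (lam * ε) ^ (d : ℝ) := by
    filter_upwards [hcover] with n hn
    calc _ ≤ ∑ _x : s n, ENNReal.ofReal (ε / lam ^ n) ^ (d : ℝ) :=
          Finset.sum_le_sum fun x _ => ENNReal.rpow_le_rpow (hdiam n x) d.coe_nonneg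
      _ = (s n).card * ENNReal.ofReal (ε / lam ^ n) ^ (d : ℝ) := by simp
      _ ≤ ENNReal.ofReal (lam ^ (n + 1)) ^ (d : ℝ) * ENNReal.ofReal (ε / lam ^ n) ^ (d : ℝ) := by
          gcongr
          exact hn.2
      _ = ENNReal.ofReal (lam * ε) ^ (d : ℝ) := by
          rw [← ENNReal.mul_rpow_of_nonneg _ _ d.coe_nonneg, ← ENNReal.ofReal_mul (by positivity)]
          congr 2
          have := (pow_pos hl0 n).ne'
          field_simp
          rw [pow_succ]
  have hlim := hle.trans ((liminf_le_limsup).trans (limsup_le_of_le (h := hbound)))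
  exact (hlim.trans_lt (ENNReal.rpow_lt_top_of_nonneg d.coe_nonneg ENNReal.ofReal_ne_top)).ne

/-- For an adapted metric, the Hausdorff dimension of any set is at most its entropy divided by
the logarithm of the expansion factor. -/
lemma IsAdapted.dimH_le_coverEntropy_div {X : Type*} [MetricSpace X] {f : X → X} {lam : ℝ}
    (hlam : IsAdapted f lam) (F : Set X) :
    dimH F ≤ (Dynamics.coverEntropy f F).toENNReal / ENNReal.ofReal (Real.log lam) := by
  borelize X
  have hlog : 0 < Real.log lam := Real.log_pos hlam.1
  refine dimH_le fun d hd => ?_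
  rw [ENNReal.le_div_iff_mul_le (Or.inl (ENNReal.ofReal_pos.2 hlog).ne')
    (Or.inl ENNReal.ofReal_ne_top)]
  have hge : ((d * Real.log lam : ℝ) : EReal) ≤ Dynamics.coverEntropy f F :=
    not_lt.1 fun hlt => hlam.hausdorffMeasure_ne_top hlt hd
  have := EReal.toENNReal_le_toENNReal hge
  rwa [EReal.toENNReal_of_ne_top (EReal.coe_ne_top _), EReal.toReal_coe,
    ENNReal.ofReal_mul d.coe_nonneg, ENNReal.ofReal_coe_nnreal] at this

theorem mainTheorem5 {X : Type*} [MetricSpace X] [CompactSpace X] (f : X → X)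
    (hf : Continuous f) (lam : ℝ) (hlam : IsAdapted f lam) {n : ℕ} (R : Fin n → Set X)
    (hR : IsMarkovPartition f R) :
    ∃ hinv : MapsTo f (partitionBoundary R) (partitionBoundary R),
      dimH (partitionBoundary R) ≤
        topEntropy (hinv.restrict f (partitionBoundary R) (partitionBoundary R)) /
          ENNReal.ofReal (Real.log lam) := by
  have hinv := hR.mapsTo_partitionBoundary hf hlam
  refine ⟨hinv, ?_⟩
  -- The entropy of the restricted map is that of `f` on the subset, where cover centres may lie
  -- anywhere in `X`.
  rw [topEntropy, Dynamics.coverEntropy_restrict hinv]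
  exact hlam.dimH_le_coverEntropy_div _
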